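/- Let $G=\mathrm{Diff}^{\omega,\delta}_+S^1$ be the group of orientation preserving real analytic diffeomorphisms of the circle $S^1=\mathbb{R}/\mathbb{Z}$, regarded as a discrete group, and let $\mathrm{SO}(2)_{\mathrm{tor}}\subset \mathrm{SO}(2)\subset G$ be the subgroup of all rational rotations, that is, the torsion subgroup of the group of rotations. Since $G$ is discrete, the homology and cohomology of its classifying space $BG$ are the group homology and cohomology of $G$ with trivial coefficients. Let $\chi\in H^2(BG;\mathbb{Q})$ be the rational Euler class, i.e. the image, under $H^2(BG;\mathbb{Z})\to H^2(BG;\mathbb{Q})$, of the class of the central extension $$0\longrightarrow \mathbb{Z}\longrightarrow \widetilde G\longrightarrow G\longrightarrow 1,$$ where $\widetilde G$ is the group of all lifts to $\mathbb{R}$ of the elements of $G$ and $\mathbb{Z}$ is generated by the translation $x\mapsto x+1$; and let $\chi^2=\chi\cup\chi$. Then $H_3(\mathrm{SO}(2)_{\mathrm{tor}};\mathbb{Z})\cong\mathbb{Q}/\mathbb{Z}$, and if the homomorphism $$H_3(\mathrm{SO}(2)_{\mathrm{tor}};\mathbb{Z})\longrightarrow H_3(BG;\mathbb{Z})$$ induced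 by the inclusion is not injective, then $\chi^2\neq 0$ in $H^4(BG;\mathbb{Q})$. -/

import Mathlib

open CategoryTheory
open scoped Manifold ContDiff

namespace FlatCircle

/-! ## Homology and cohomology of a discrete group with untwisted coefficients -/

section Cohomology

variable (G : Type) [Group G]

/-- `H_n(BG; A)` for the discrete group `G` and the abelian group `A`: the homology of the bar
complex, with `G` acting trivially on `A`. -/
noncomputable abbrev GrpHomology (A : Type) [AddCommGroup A] (n : ℕ) : ModuleCat ℤ :=
  groupHomology (Rep.trivial ℤ G A) n

/-- `Hⁿ(BG; A)` for the discrete group `G` and the abelian group `A`: the cohomology of the complex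
of inhomogeneous cochains `Gⁿ → A`, with `G` acting trivially on `A`. -/
noncomputable abbrev GrpCohomology (A : Type) [AddCommGroup A] (n : ℕ) : ModuleCat ℤ :=
  groupCohomology (Rep.trivial ℤ G A) n

variable {G}

/-- The map `H_n(BS; A) → H_n(BG; A)` induced by the inclusion of a subgroup `S` of `G`. -/
noncomputable def homologyInclusion (S : Subgroup G) (A : Type) [AddCommGroup A] (n : ℕ) :
    GrpHomology S A n ⟶ GrpHomology G A n :=
  groupHomology.map (A := Rep.trivial ℤ S A) (B := Rep.trivial ℤ G A) S.subtype
    (Rep.ofHom ⟨LinearMap.id, fun _ => rfl⟩) n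

/-- The map `Hⁿ(BG; A) → Hⁿ(BG; B)` induced by a homomorphism `A → B` of coefficient groups. -/
noncomputable def coeffMap {A B : Type} [AddCommGroup A] [AddCommGroup B] (φ : A →+ B) (n : ℕ) :
    GrpCohomology G A n ⟶ GrpCohomology G B n :=
  groupCohomology.map (A := Rep.trivial ℤ G A) (B := Rep.trivial ℤ G B) (MonoidHom.id G)
    (Rep.ofHom ⟨φ.toIntLinearMap, fun _ => rfl⟩) n

/-! ### The cup product -/

variable {R : Type} [CommRing R] {p q n : ℕ}

/-- The differential of the complex of inhomogeneous cochains `Gⁿ → A`. -/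
noncomputable abbrev coboundary {A : Type} [AddCommGroup A] (n : ℕ) (a : (Fin n → G) → A) :
    (Fin (n + 1) → G) → A :=
  inhomogeneousCochains.d (Rep.trivial ℤ G A) n a

theorem coboundary_apply {A : Type} [AddCommGroup A] (a : (Fin n → G) → A)
    (g : Fin (n + 1) → G) :
    coboundary n a g = a (fun i => g i.succ) +
      ∑ j : Fin (n + 1), (-1 : ℤ) ^ ((j : ℕ) + 1) • a (Fin.contractNth j (· * ·) g) := rfl

/-- The cup product of inhomogeneous cochains:
`(a ∪ b)(g₁, …, g_{p+q}) = a(g₁, …, g_p) b(g_{p+1}, …, g_{p+q})`. -/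
def cupCochain (h : p + q = n) (a : (Fin p → G) → R) (b : (Fin q → G) → R) :
    (Fin n → G) → R :=
  fun g => a (fun i => g ⟨i, by omega⟩) * b (fun j => g ⟨p + j, by omega⟩)

/-- The sequence `(u₀, …, u_j u_{j+1}, …)` obtained from `u` by multiplying two neighbours. -/
def contractSeq (j : ℕ) (u : ℕ → G) (k : ℕ) : G :=
  if k < j then u k else if k = j then u k * u (k + 1) else u (k + 1)

theorem coboundary_seq {A : Type} [AddCommGroup A] (a : (Fin n → G) → A) (u : ℕ → G) :
    coboundary n a (fun i => u i) = a (fun i => u (i + 1)) +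
      ∑ j ∈ Finset.range (n + 1), (-1 : ℤ) ^ (j + 1) • a (fun k => contractSeq j u k) := by
  rw [coboundary_apply, Finset.sum_range]
  congr 1

theorem exists_seq (g : Fin n → G) : ∃ u : ℕ → G, g = fun i : Fin n => u i :=
  ⟨fun k => if h : k < n then g ⟨k, h⟩ else 1, by funext i; simp⟩

theorem cupCochain_seq {G : Type} (h : p + q = n) (a : (Fin p → G) → R) (b : (Fin q → G) → R)
    (u : ℕ → G) :
    cupCochain h a b (fun i => u i) = a (fun i => u i) * b (fun j => u (p + j)) := rfl

/-- The Leibniz rule. -/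
theorem coboundary_cupCochain (h : p + q = n) (a : (Fin p → G) → R) (b : (Fin q → G) → R) :
    coboundary n (cupCochain h a b) =
      cupCochain (p := p + 1) (n := n + 1) (by omega) (coboundary p a) b +
      (-1 : ℤ) ^ p • cupCochain (q := q + 1) (n := n + 1) (by omega) a (coboundary q b) := by
  subst h
  funext g
  obtain ⟨u, rfl⟩ := exists_seq g
  rw [Pi.add_apply, Pi.smul_apply, coboundary_seq, cupCochain_seq, cupCochain_seq, coboundary_seq,
    coboundary_seq b fun k => u (p + k)]
  have h1 : ∀ j ∈ Finset.range p,
      (-1 : ℤ) ^ (j + 1) • cupCochain rfl a b (fun k => contractSeq j u k) =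
      ((-1 : ℤ) ^ (j + 1) • a (fun k => contractSeq j u k)) * b (fun i => u (p + 1 + i)) := by
    intro j hj
    rw [Finset.mem_range] at hj
    rw [cupCochain_seq, smul_mul_assoc]
    congr 3
    funext i
    have e : p + 1 + (i : ℕ) = p + i + 1 := by omega
    simp only [contractSeq, e]
    rw [if_neg (by omega), if_neg (by omega)]
  have h2 : ∀ j ∈ Finset.range (q + 1),
      (-1 : ℤ) ^ (p + j + 1) • cupCochain rfl a b (fun k => contractSeq (p + j) u k) =
      (-1 : ℤ) ^ p • (a (fun k => u k) *
        ((-1 : ℤ) ^ (j + 1) • b (fun i => contractSeq j (fun k => u (p + k)) i))) := by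
    intro j hj
    rw [cupCochain_seq, mul_smul_comm, smul_smul, ← pow_add, add_assoc]
    congr 3
    · funext i
      simp only [contractSeq]
      rw [if_pos (by omega)]
    · funext i
      simp only [contractSeq, add_lt_add_iff_left, add_right_inj, add_assoc]
  have h3 : a (fun k => contractSeq p u k) = a (fun k => u k) := by
    congr 1
    funext i
    simp only [contractSeq]
    rw [if_pos (by omega)]
  have e1 : cupCochain rfl a b (fun i : Fin (p + q) => u (i + 1)) =
      a (fun i => u (i + 1)) * b (fun i => u (p + 1 + i)) := by
    rw [cupCochain_seq rfl a b fun i => u (i + 1)]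
    congr 2
    funext i
    congr 1
    omega
  have e2 : (fun i : Fin q => u (p + (i + 1))) = fun i : Fin q => u (p + 1 + i) := by
    funext i
    congr 1
    omega
  rw [add_assoc p q 1, Finset.sum_range_add, Finset.sum_congr rfl h1, Finset.sum_congr rfl h2, e1,
    e2, Finset.sum_range_succ _ p, h3, ← Finset.smul_sum, ← Finset.mul_sum, ← Finset.sum_mul]
  simp only [zsmul_eq_mul]
  push_cast
  ring

/-- The cup product of two cocycles is a cocycle. -/
theorem coboundary_cupCochain_eq_zero (h : p + q = n) {a : (Fin p → G) → R}
    {b : (Fin q → G) → R} (ha : coboundary p a = 0) (hb : coboundary q b = 0) :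
    coboundary n (cupCochain h a b) = 0 := by
  rw [coboundary_cupCochain, ha, hb]
  funext g
  simp [cupCochain]

/-- The class in `Hⁿ(BG; A)` of a cocycle `Gⁿ → A`. -/
noncomputable def classOf {A : Type} [AddCommGroup A] (a : (Fin n → G) → A)
    (ha : coboundary n a = 0) : GrpCohomology G A n :=
  groupCohomology.π (Rep.trivial ℤ G A) n (groupCohomology.cocyclesMk a ha)

theorem exists_classOf_eq {A : Type} [AddCommGroup A] (x : GrpCohomology G A n) :
    ∃ (a : (Fin n → G) → A) (ha : coboundary n a = 0), classOf a ha = x := by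
  induction x using groupCohomology_induction_on with
  | h z =>
    have hz : coboundary n (groupCohomology.iCocycles (Rep.trivial ℤ G A) n z) = 0 := by
      have := (groupCohomology.inhomogeneousCochains (Rep.trivial ℤ G A)).iCycles_d n (n + 1)
      rw [groupCohomology.inhomogeneousCochains.d_def] at this
      exact congr($(this).hom z)
    refine ⟨_, hz, ?_⟩
    rw [classOf]
    congr 1
    apply (ModuleCat.mono_iff_injective (groupCohomology.iCocycles (Rep.trivial ℤ G A) n)).1
      inferInstance
    rw [groupCohomology.iCocycles_mk]

theorem classOf_add {A : Type} [AddCommGroup A] {a b : (Fin n → G) → A}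
    (ha : coboundary n a = 0) (hb : coboundary n b = 0) (hab : coboundary n (a + b) = 0) :
    classOf (a + b) hab = classOf a ha + classOf b hb := by
  rw [classOf, classOf, classOf, ← map_add]
  congr 1
  apply (ModuleCat.mono_iff_injective (groupCohomology.iCocycles (Rep.trivial ℤ G A) n)).1
    inferInstance
  rw [map_add, groupCohomology.iCocycles_mk, groupCohomology.iCocycles_mk,
    groupCohomology.iCocycles_mk]

theorem classOf_eq_zero_iff_aux {A : Type} [AddCommGroup A] {a : (Fin n → G) → A}
    (ha : coboundary n a = 0) (i : ℕ) (hi : (ComplexShape.up ℕ).prev n = i) :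
    classOf a ha = 0 ↔
      ∃ c, (groupCohomology.inhomogeneousCochains (Rep.trivial ℤ G A)).d i n c = a := by
  let K := groupCohomology.inhomogeneousCochains (Rep.trivial ℤ G A)
  have ex : (ShortComplex.mk (K.toCycles i n) (K.homologyπ n)
      (K.toCycles_comp_homologyπ i n)).Exact :=
    ShortComplex.exact_of_g_is_cokernel _ (K.homologyIsCokernel i n hi)
  have hinj := (ModuleCat.mono_iff_injective (K.iCycles n)).1 inferInstance
  have hmk : K.iCycles n (groupCohomology.cocyclesMk (A := Rep.trivial ℤ G A) a ha) = a :=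
    groupCohomology.iCocycles_mk (A := Rep.trivial ℤ G A) a ha
  have hd : ∀ c, K.iCycles n (K.toCycles i n c) = K.d i n c := fun c =>
    congr($(K.toCycles_i i n).hom c)
  constructor
  · intro h
    obtain ⟨c, hc⟩ := (ShortComplex.moduleCat_exact_iff _).1 ex _ h
    refine ⟨c, ?_⟩
    rw [← hd]
    exact (congrArg (K.iCycles n) hc).trans hmk
  · rintro ⟨c, hc⟩
    have : groupCohomology.cocyclesMk a ha = K.toCycles i n c :=
      hinj (hmk.trans (hc.symm.trans (hd c).symm))
    rw [classOf, this]
    exact congr($(K.toCycles_comp_homologyπ i n).hom c)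

theorem classOf_eq_zero_iff {A : Type} [AddCommGroup A] {a : (Fin (n + 1) → G) → A}
    (ha : coboundary (n + 1) a = 0) :
    classOf a ha = 0 ↔ ∃ c : (Fin n → G) → A, coboundary n c = a := by
  rw [classOf_eq_zero_iff_aux ha n (by simp), groupCohomology.inhomogeneousCochains.d_def]

theorem classOf_zero_eq_zero_iff {A : Type} [AddCommGroup A] {a : (Fin 0 → G) → A}
    (ha : coboundary 0 a = 0) : classOf a ha = 0 ↔ a = 0 := by
  rw [classOf_eq_zero_iff_aux ha _ rfl, HomologicalComplex.shape _ _ _ (by simp)]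
  exact ⟨fun ⟨_, h⟩ => h.symm, fun h => ⟨0, h.symm⟩⟩

/-- The cup product `Hᵖ(BG; R) × H^q(BG; R) → H^{p+q}(BG; R)`, computed on cocycles that represent
the two classes; by `cup_classOf` the result does not depend on the choice of the cocycles. -/
noncomputable def cup (h : p + q = n) (x : GrpCohomology G R p) (y : GrpCohomology G R q) :
    GrpCohomology G R n :=
  classOf (cupCochain h (exists_classOf_eq x).choose (exists_classOf_eq y).choose)
    (coboundary_cupCochain_eq_zero h (exists_classOf_eq x).choose_spec.choose
      (exists_classOf_eq y).choose_spec.choose)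

theorem coboundary_sub_eq_zero {A : Type} [AddCommGroup A] {a b : (Fin n → G) → A}
    (ha : coboundary n a = 0) (hb : coboundary n b = 0) : coboundary n (a - b) = 0 := by
  rw [coboundary, map_sub]
  exact (congrArg₂ (· - ·) ha hb).trans (sub_zero _)

theorem classOf_eq_of_sub {A : Type} [AddCommGroup A] {a b : (Fin n → G) → A}
    (ha : coboundary n a = 0) (hb : coboundary n b = 0) :
    classOf (a - b) (coboundary_sub_eq_zero ha hb) = 0 ↔ classOf a ha = classOf b hb := by
  have := classOf_add (coboundary_sub_eq_zero ha hb) hb (by rw [sub_add_cancel]; exact ha)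
  simp only [sub_add_cancel] at this
  rw [this, add_eq_right]

theorem classOf_cup_left {a : (Fin p → G) → R} {b : (Fin q → G) → R} (h : p + q = n)
    (ha : coboundary p a = 0) (hb : coboundary q b = 0) (h0 : classOf a ha = 0) :
    classOf (cupCochain h a b) (coboundary_cupCochain_eq_zero h ha hb) = 0 := by
  rcases p with _ | p
  · rw [classOf_zero_eq_zero_iff] at h0
    subst h0
    have : cupCochain h (0 : (Fin 0 → G) → R) b = 0 := by funext g; simp [cupCochain]
    simp only [this]
    rw [classOf_eq_zero_iff_aux _ _ rfl]
    exact ⟨0, map_zero _⟩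
  · obtain ⟨c, rfl⟩ := (classOf_eq_zero_iff ha).1 h0
    obtain ⟨m, rfl⟩ : ∃ m, n = m + 1 := ⟨n - 1, by omega⟩
    rw [classOf_eq_zero_iff]
    refine ⟨cupCochain (by omega) c b, ?_⟩
    rw [coboundary_cupCochain, hb]
    funext g
    simp [cupCochain]

theorem classOf_cup_right {a : (Fin p → G) → R} {b : (Fin q → G) → R} (h : p + q = n)
    (ha : coboundary p a = 0) (hb : coboundary q b = 0) (h0 : classOf b hb = 0) :
    classOf (cupCochain h a b) (coboundary_cupCochain_eq_zero h ha hb) = 0 := by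
  rcases q with _ | q
  · rw [classOf_zero_eq_zero_iff] at h0
    subst h0
    have : cupCochain h a (0 : (Fin 0 → G) → R) = 0 := by funext g; simp [cupCochain]
    simp only [this]
    rw [classOf_eq_zero_iff_aux _ _ rfl]
    exact ⟨0, map_zero _⟩
  · obtain ⟨c, rfl⟩ := (classOf_eq_zero_iff hb).1 h0
    obtain ⟨m, rfl⟩ : ∃ m, n = m + 1 := ⟨n - 1, by omega⟩
    rw [classOf_eq_zero_iff]
    refine ⟨(-1 : ℤ) ^ p • cupCochain (by omega) a c, ?_⟩
    have hl : coboundary m ((-1 : ℤ) ^ p • cupCochain (by omega) a c) =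
        (-1 : ℤ) ^ p • coboundary m (cupCochain (by omega) a c) := map_zsmul _ _ _
    rw [hl, coboundary_cupCochain, ha]
    funext g
    simp [cupCochain, ← mul_assoc, ← mul_pow]

/-- The cup product of the classes of two cocycles is the class of their cup product. -/
theorem cup_classOf (h : p + q = n) {a : (Fin p → G) → R} {b : (Fin q → G) → R}
    (ha : coboundary p a = 0) (hb : coboundary q b = 0) :
    cup h (classOf a ha) (classOf b hb) =
      classOf (cupCochain h a b) (coboundary_cupCochain_eq_zero h ha hb) := by
  have key : ∀ (a' : (Fin p → G) → R) (b' : (Fin q → G) → R) (ha' : coboundary p a' = 0)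
      (hb' : coboundary q b' = 0), classOf a' ha' = classOf a ha → classOf b' hb' = classOf b hb →
      classOf (cupCochain h a' b') (coboundary_cupCochain_eq_zero h ha' hb') =
        classOf (cupCochain h a b) (coboundary_cupCochain_eq_zero h ha hb) := by
    intro a' b' ha' hb' hae hbe
    have h1 := classOf_cup_left h (coboundary_sub_eq_zero ha' ha) hb'
      ((classOf_eq_of_sub ha' ha).2 hae)
    have h2 := classOf_cup_right h ha (coboundary_sub_eq_zero hb' hb)
      ((classOf_eq_of_sub hb' hb).2 hbe)
    have e1 : cupCochain h (a' - a) b' = cupCochain h a' b' - cupCochain h a b' := by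
      funext g; simp [cupCochain, sub_mul]
    have e2 : cupCochain h a (b' - b) = cupCochain h a b' - cupCochain h a b := by
      funext g; simp [cupCochain, mul_sub]
    simp only [e1] at h1
    simp only [e2] at h2
    rw [classOf_eq_of_sub (coboundary_cupCochain_eq_zero h ha' hb')
      (coboundary_cupCochain_eq_zero h ha hb')] at h1
    rw [classOf_eq_of_sub (coboundary_cupCochain_eq_zero h ha hb')
      (coboundary_cupCochain_eq_zero h ha hb)] at h2
    exact h1.trans h2
  exact key _ _ _ _ (exists_classOf_eq (classOf a ha)).choose_spec.choose_spec
    (exists_classOf_eq (classOf b hb)).choose_spec.choose_spec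

end Cohomology

/-! ## The circle and its real analytic diffeomorphisms -/

/-- The universal covering `ℝ → S¹`, `x ↦ exp(2πix)`, whose deck group is generated by
`T(x) = x + 1`. -/
noncomputable def cover (x : ℝ) : Circle := Circle.exp (2 * Real.pi * x)

theorem cover_add (x y : ℝ) : cover (x + y) = cover x * cover y := by
  simp [cover, mul_add, Circle.exp_add]

theorem cover_eq_iff {x y : ℝ} : cover x = cover y ↔ ∃ m : ℤ, x = y + m := by
  have hpi := Real.pi_pos
  rw [cover, cover, Circle.exp_eq_exp]
  refine exists_congr fun m => ⟨fun h => ?_, fun h => by rw [h]; ring⟩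
  have : (2 * Real.pi) * x = (2 * Real.pi) * (y + m) := by rw [h]; ring
  exact mul_left_cancel₀ (by positivity) this

theorem cover_surjective : Function.Surjective cover := by
  intro z
  obtain ⟨t, rfl⟩ := Circle.exp_surjective z
  exact ⟨t / (2 * Real.pi), by rw [cover, mul_div_cancel₀ _ (by positivity)]⟩

/-- The increasing bijection `F` of `ℝ` is a lift of the bijection `f` of `S¹`. -/
def IsLift (F : ℝ ≃o ℝ) (f : Equiv.Perm Circle) : Prop :=
  ∀ x : ℝ, f (cover x) = cover (F x)

/-- A homeomorphism of `S¹` preserves the orientation if and only if it lifts to an increasing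
bijection of `ℝ`. -/
def PreservesOrientation (f : Equiv.Perm Circle) : Prop := ∃ F : ℝ ≃o ℝ, IsLift F f

/-- The group of orientation preserving real analytic diffeomorphisms of `S¹`, as an abstract
(discrete) group; the multiplication is the composition. -/
def analyticDiff : Subgroup (Equiv.Perm Circle) where
  carrier := {f | ContMDiff (𝓡 1) (𝓡 1) ω f ∧ ContMDiff (𝓡 1) (𝓡 1) ω f.symm ∧
    PreservesOrientation f}
  mul_mem' := by
    rintro f g ⟨hf, hf', F, hF⟩ ⟨hg, hg', H, hH⟩
    refine ⟨hf.comp hg, hg'.comp hf', H.trans F, fun x => ?_⟩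
    rw [Equiv.Perm.mul_apply, hH, hF]
    rfl
  one_mem' := ⟨contMDiff_id, contMDiff_id, OrderIso.refl ℝ, fun _ => rfl⟩
  inv_mem' := by
    rintro f ⟨hf, hf', F, hF⟩
    refine ⟨hf', hf, F.symm, fun x => ?_⟩
    rw [Equiv.Perm.inv_eq_iff_eq, hF, F.apply_symm_apply]

/-- The rotations of `S¹`, as a homomorphism `SO(2) = S¹ → Diff`. -/
noncomputable def rotation : Circle →* analyticDiff where
  toFun z := ⟨Equiv.mulLeft z, contMDiff_mul_left, contMDiff_mul_left, by
    obtain ⟨t, rfl⟩ := cover_surjective z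
    exact ⟨OrderIso.addLeft t, fun x => (cover_add t x).symm⟩⟩
  map_one' := by
    ext x
    simp
  map_mul' z w := by
    ext x
    simp

/-- `SO(2)_tor`: the group of rational rotations, i.e. of rotations of finite order, as a subgroup
of the group of real analytic diffeomorphisms. -/
noncomputable def rationalRotations : Subgroup analyticDiff :=
  (CommGroup.torsion Circle).map rotation

/-! ## The Euler class

The lifts to `ℝ` of the elements of `G` form a central extension of `G` by the group `ℤ` of
integral translations. Its class in `H²(G; ℤ)` is the Euler class of the universal flat circle
bundle. It is computed here with the section that picks the lift `F` with `0 ≤ F 0 < 1`. -/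

theorem IsLift.map_add_one {F : ℝ ≃o ℝ} {f : Equiv.Perm Circle} (h : IsLift F f) (x : ℝ) :
    F (x + 1) = F x + 1 := by
  have h1 : cover (F (x + 1)) = cover (F x) := by
    rw [← h, ← h]
    congr 1
    exact cover_eq_iff.2 ⟨1, by simp⟩
  obtain ⟨n, hn⟩ := cover_eq_iff.1 h1
  have hlt : F x < F (x + 1) := F.strictMono (by linarith)
  have hn1 : (1 : ℝ) ≤ n := by
    have : (0 : ℝ) < n := by linarith
    exact_mod_cast this
  obtain ⟨y, hy⟩ := F.surjective (F x + 1)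
  have h2 : cover y = cover x := by
    apply f.injective
    rw [h, h, hy]
    exact cover_eq_iff.2 ⟨1, by simp⟩
  obtain ⟨m, hm⟩ := cover_eq_iff.1 h2
  have hxy : x < y := F.lt_iff_lt.1 (by linarith)
  have hyx : y ≤ x + 1 := F.le_iff_le.1 (by linarith)
  have hm0 : (0 : ℝ) < m := by linarith
  have hm1 : (m : ℝ) ≤ 1 := by linarith
  have hm' : m = 1 := by
    have a : 0 < m := by exact_mod_cast hm0
    have b : m ≤ 1 := by exact_mod_cast hm1
    omega
  rw [hm', Int.cast_one] at hm
  rw [← hm, hy]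

theorem IsLift.map_add_int {F : ℝ ≃o ℝ} {f : Equiv.Perm Circle} (h : IsLift F f) (x : ℝ)
    (n : ℤ) : F (x + n) = F x + n :=
  CircleDeg1Lift.map_add_int ⟨⟨F, F.monotone⟩, h.map_add_one⟩ x n

/-- Two lifts differ by an integral translation. -/
theorem IsLift.exists_eq_add_int {F H : ℝ ≃o ℝ} {f : Equiv.Perm Circle} (hF : IsLift F f)
    (hH : IsLift H f) : ∃ n : ℤ, ∀ x, F x = H x + n := by
  have hex : ∀ x, ∃ n : ℤ, F x = H x + n := fun x =>
    cover_eq_iff.1 ((hF x).symm.trans (hH x))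
  choose n hn using hex
  have hc : Continuous n := by
    rw [Int.isClosedEmbedding_coe_real.isEmbedding.continuous_iff]
    have : (fun k : ℤ => (k : ℝ)) ∘ n = fun x => F x - H x := by
      funext x
      simp [hn x]
    exact this ▸ F.continuous.sub H.continuous
  refine ⟨n 0, fun x => ?_⟩
  rw [hn x, PreconnectedSpace.constant inferInstance hc]

theorem exists_lift (f : analyticDiff) :
    ∃ F : ℝ ≃o ℝ, IsLift F f ∧ 0 ≤ F 0 ∧ F 0 < 1 := by
  obtain ⟨F, hF⟩ := f.2.2.2
  refine ⟨F.trans (OrderIso.addRight (-(⌊F 0⌋ : ℝ))), fun x => ?_, ?_, ?_⟩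
  · rw [hF]
    exact cover_eq_iff.2 ⟨⌊F 0⌋, by simp⟩
  · simpa using Int.floor_le (F 0)
  · have := Int.lt_floor_add_one (F 0)
    simp only [OrderIso.trans_apply, OrderIso.addRight_apply]
    linarith

/-- The lift `F` of a diffeomorphism of the circle with `0 ≤ F 0 < 1`. -/
noncomputable def lift (f : analyticDiff) : ℝ ≃o ℝ := (exists_lift f).choose

theorem isLift_lift (f : analyticDiff) : IsLift (lift f) f := (exists_lift f).choose_spec.1

theorem lift_zero_nonneg (f : analyticDiff) : 0 ≤ lift f 0 := (exists_lift f).choose_spec.2.1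

theorem lift_zero_lt_one (f : analyticDiff) : lift f 0 < 1 := (exists_lift f).choose_spec.2.2

/-- The integer `c(f, g)` with `lift f ∘ lift g = T^{c(f, g)} ∘ lift (f ∘ g)`, see `lift_lift`. -/
noncomputable def eulerInt (f g : analyticDiff) : ℤ := ⌊lift f (lift g 0)⌋

theorem lift_lift (f g : analyticDiff) (x : ℝ) :
    lift f (lift g x) = lift (f * g) x + eulerInt f g := by
  have h : IsLift ((lift g).trans (lift f)) (f * g : analyticDiff) := fun y => by
    rw [Subgroup.coe_mul, Equiv.Perm.mul_apply, isLift_lift g, isLift_lift f]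
    rfl
  obtain ⟨n, hn⟩ := h.exists_eq_add_int (isLift_lift (f * g))
  have h0 : lift f (lift g 0) = lift (f * g) 0 + n := hn 0
  have : eulerInt f g = n := by
    rw [eulerInt, h0, Int.floor_add_intCast, Int.floor_eq_zero_iff.2
      ⟨lift_zero_nonneg _, lift_zero_lt_one _⟩, zero_add]
  rw [this]
  exact hn x

theorem eulerInt_cocycle (f g h : analyticDiff) :
    eulerInt f g + eulerInt (f * g) h = eulerInt g h + eulerInt f (g * h) := by
  have h1 : lift f (lift g (lift h 0)) =
      lift (f * g * h) 0 + eulerInt (f * g) h + eulerInt f g := by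
    rw [lift_lift f g, lift_lift (f * g) h]
  have h2 : lift f (lift g (lift h 0)) =
      lift (f * g * h) 0 + eulerInt f (g * h) + eulerInt g h := by
    rw [lift_lift g h, (isLift_lift f).map_add_int, lift_lift f (g * h), mul_assoc]
  have : (eulerInt f g + eulerInt (f * g) h : ℝ) = eulerInt g h + eulerInt f (g * h) := by
    linarith
  exact_mod_cast this

/-- The cocycle of the central extension given by the lifts. -/
noncomputable def eulerCocycle (g : Fin 2 → analyticDiff) : ℤ := eulerInt (g 0) (g 1)

theorem coboundary_eulerCocycle : coboundary 2 eulerCocycle = 0 := by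
  funext g
  have := eulerInt_cocycle (g 0) (g 1) (g 2)
  rw [coboundary_apply]
  simp [Fin.sum_univ_three, eulerCocycle, Fin.contractNth]
  linarith

/-- The Euler class in `H²(G; ℤ)`. -/
noncomputable def eulerClass : GrpCohomology analyticDiff ℤ 2 :=
  classOf eulerCocycle coboundary_eulerCocycle

/-- The rational Euler class `χ` in `H²(G; ℚ)`, the image of the integral one. -/
noncomputable def rationalEulerClass : GrpCohomology analyticDiff ℚ 2 :=
  coeffMap (Int.castAddHom ℚ) 2 eulerClass

end FlatCircle

namespace FlatCircle

section Evaluation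

variable {G : Type} [Group G] {M N : Type} [AddCommGroup M] [AddCommGroup N] {n : ℕ}

/-- The value of an inhomogeneous cochain on inhomogeneous chains. -/
noncomputable def chainEval (a : (Fin n → G) → M) :
    (groupHomology.inhomogeneousChains (Rep.trivial ℤ G ℤ)).X n ⟶ ModuleCat.of ℤ M :=
  ModuleCat.ofHom (Finsupp.linearCombination ℤ a)

theorem d_chainEval (a : (Fin n → G) → M) :
    (groupHomology.inhomogeneousChains (Rep.trivial ℤ G ℤ)).d (n + 1) n ≫ chainEval a =
      chainEval (coboundary n a) := by
  rw [groupHomology.inhomogeneousChains.d_def]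
  refine groupHomology.inhomogeneousChains.ext fun g => ?_
  ext
  simp [chainEval, groupHomology.inhomogeneousChains.d, coboundary_apply,
    Finsupp.linearCombination_single]

/-- The homomorphism `H_n(BG; ℤ) → M` given by evaluation of a cocycle. -/
noncomputable def homologyEval (a : (Fin n → G) → M) (ha : coboundary n a = 0) :
    GrpHomology G ℤ n ⟶ ModuleCat.of ℤ M :=
  (groupHomology.inhomogeneousChains (Rep.trivial ℤ G ℤ)).homologyι n ≫
    (groupHomology.inhomogeneousChains (Rep.trivial ℤ G ℤ)).descOpcycles (chainEval a) (n + 1)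
      (by simp) (by rw [d_chainEval, ha]; ext; simp [chainEval])

theorem homologyEval_π (a : (Fin n → G) → M) (ha : coboundary n a = 0)
    (z : groupHomology.cycles (Rep.trivial ℤ G ℤ) n) :
    homologyEval a ha (groupHomology.π _ n z) =
      Finsupp.linearCombination ℤ a (groupHomology.iCycles (Rep.trivial ℤ G ℤ) n z) := by
  have : groupHomology.π _ n ≫ homologyEval a ha =
      groupHomology.iCycles (Rep.trivial ℤ G ℤ) n ≫ chainEval a :=
    (HomologicalComplex.homology_π_ι_assoc _ _).trans
      (congrArg (CategoryStruct.comp _) (HomologicalComplex.p_descOpcycles _ _ _ _ _))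
  exact congr($(this).hom z)

theorem homologyEval_add (a b : (Fin n → G) → M) (ha : coboundary n a = 0)
    (hb : coboundary n b = 0) (hab : coboundary n (a + b) = 0) (x : GrpHomology G ℤ n) :
    homologyEval (a + b) hab x = homologyEval a ha x + homologyEval b hb x := by
  induction x using groupHomology_induction_on with
  | h z =>
    rw [homologyEval_π, homologyEval_π, homologyEval_π]
    simp [Finsupp.linearCombination_apply, Finsupp.sum_add]

theorem coboundary_comp_addMonoidHom (φ : M →+ N) (a : (Fin n → G) → M) :
    coboundary n (φ ∘ a) = φ ∘ coboundary n a := by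
  funext g
  simp [coboundary_apply]

theorem homologyEval_comp_addMonoidHom (φ : M →+ N) (a : (Fin n → G) → M)
    (ha : coboundary n a = 0) (hb : coboundary n (φ ∘ a) = 0) (x : GrpHomology G ℤ n) :
    homologyEval (φ ∘ a) hb x = φ (homologyEval a ha x) := by
  induction x using groupHomology_induction_on with
  | h z =>
    rw [homologyEval_π, homologyEval_π]
    simp [Finsupp.linearCombination_apply, Finsupp.sum, map_sum]

theorem coboundary_restrict (S : Subgroup G) (a : (Fin n → G) → M) :
    coboundary n (fun s : Fin n → S => a (fun i => s i)) =
      fun s => coboundary n a (fun i => s i) := by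
  funext s
  rw [coboundary_apply, coboundary_apply]
  congr 1
  refine Finset.sum_congr rfl fun j _ => ?_
  congr 2
  exact Fin.comp_contractNth (· * ·) (· * ·) (fun _ _ => rfl) j s

/-- The trivial coefficients of a subgroup as a restriction. -/
noncomputable def trivialRestrict (S : Subgroup G) :
    Rep.trivial ℤ S ℤ ⟶ Rep.res S.subtype (Rep.trivial ℤ G ℤ) :=
  Rep.ofHom ⟨LinearMap.id, fun _ => rfl⟩

theorem chainsMap_trivialRestrict (S : Subgroup G) (b : (Fin n → S) →₀ ℤ) :
    (groupHomology.chainsMap S.subtype (trivialRestrict S)).f n b =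
      Finsupp.mapDomain (fun s : Fin n → S => fun i => (s i : G)) b := by
  induction b using Finsupp.induction_linear with
  | zero => exact (map_zero _).trans Finsupp.mapDomain_zero.symm
  | add b c hb hc =>
    exact (map_add _ b c).trans ((congrArg₂ (· + ·) hb hc).trans Finsupp.mapDomain_add.symm)
  | single s k =>
    exact (groupHomology.chainsMap_f_single _ _ _ _ _).trans Finsupp.mapDomain_single.symm

theorem homologyInclusion_π (S : Subgroup G)
    (z : groupHomology.cycles (Rep.trivial ℤ S ℤ) n) :
    ∃ w : groupHomology.cycles (Rep.trivial ℤ G ℤ) n,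
      homologyInclusion S ℤ n (groupHomology.π _ n z) = groupHomology.π _ n w ∧
      groupHomology.iCycles (Rep.trivial ℤ G ℤ) n w =
        Finsupp.mapDomain (fun s : Fin n → S => fun i => (s i : G))
          (groupHomology.iCycles (Rep.trivial ℤ S ℤ) n z) := by
  refine ⟨groupHomology.cyclesMap S.subtype (trivialRestrict S) n z, ?_, ?_⟩
  · exact congr($(groupHomology.π_map S.subtype (trivialRestrict S) n).hom z)
  · exact congr($(HomologicalComplex.cyclesMap_i
      (groupHomology.chainsMap S.subtype (trivialRestrict S)) n).hom z).trans
      (chainsMap_trivialRestrict S _)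

theorem homologyEval_homologyInclusion (S : Subgroup G) (a : (Fin n → G) → M)
    (ha : coboundary n a = 0) (hS : coboundary n (fun s : Fin n → S => a (fun i => s i)) = 0)
    (x : GrpHomology S ℤ n) :
    homologyEval a ha (homologyInclusion S ℤ n x) = homologyEval _ hS x := by
  induction x using groupHomology_induction_on with
  | h z =>
    obtain ⟨w, hw, hwz⟩ := homologyInclusion_π S z
    rw [hw, homologyEval_π, homologyEval_π, hwz, Finsupp.linearCombination_mapDomain]
    rfl

/-- A homology class is supported on finitely many elements of the group. -/
theorem exists_finset_mem_range_homologyInclusion (x : GrpHomology G ℤ n) :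
    ∃ T : Finset G, ∀ S : Subgroup G, (∀ t ∈ T, t ∈ S) → ∃ y, homologyInclusion S ℤ n y = x := by
  classical
  induction x using groupHomology_induction_on with
  | h z =>
    let c : (Fin n → G) →₀ ℤ := groupHomology.iCycles (Rep.trivial ℤ G ℤ) n z
    refine ⟨c.support.biUnion fun g => Finset.univ.image g, fun S hS => ?_⟩
    let ι : (Fin n → S) → (Fin n → G) := fun s i => s i
    have hι : Function.Injective ι := fun s t h => by
      funext i
      exact Subtype.ext (congrFun h i)
    let c' : (Fin n → S) →₀ ℤ := c.comapDomain ι hι.injOn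
    have hc' : Finsupp.mapDomain ι c' = c := by
      refine Finsupp.mapDomain_comapDomain ι hι c fun g hg => ?_
      exact ⟨fun i => ⟨g i, hS _ (Finset.mem_biUnion.2 ⟨g, hg,
        Finset.mem_image_of_mem _ (Finset.mem_univ _)⟩)⟩, rfl⟩
    have hd : (groupHomology.inhomogeneousChains (Rep.trivial ℤ S ℤ)).d n
        ((ComplexShape.down ℕ).next n) c' = 0 := by
      have h1 := congr($((groupHomology.chainsMap S.subtype (trivialRestrict S)).comm n
        ((ComplexShape.down ℕ).next n)).hom c')
      have h2 := congr($((groupHomology.inhomogeneousChains (Rep.trivial ℤ G ℤ)).iCycles_d n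
        ((ComplexShape.down ℕ).next n)).hom z)
      have h3 : (groupHomology.inhomogeneousChains (Rep.trivial ℤ G ℤ)).d n
          ((ComplexShape.down ℕ).next n)
          ((groupHomology.chainsMap S.subtype (trivialRestrict S)).f n c') = 0 := by
        rw [chainsMap_trivialRestrict, hc']
        exact h2
      have h4 := (chainsMap_trivialRestrict S _).symm.trans (h1.symm.trans h3)
      refine Finsupp.mapDomain_injective (fun s t h => ?_) (h4.trans Finsupp.mapDomain_zero.symm)
      funext i
      exact Subtype.ext (congrFun h i)
    refine ⟨groupHomology.π _ n (groupHomology.cyclesMk n _ rfl c' hd), ?_⟩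
    obtain ⟨w, hw, hwz⟩ := homologyInclusion_π S (groupHomology.cyclesMk n _ rfl c' hd)
    rw [hw]
    congr 1
    apply (ModuleCat.mono_iff_injective (groupHomology.iCycles (Rep.trivial ℤ G ℤ) n)).1
      inferInstance
    rw [hwz, groupHomology.iCycles_mk]
    exact hc'

end Evaluation

section PowerCycle

variable {G : Type} [Group G]

/-- For `g ^ n = 1` the chain `∑ i < n, [g | g ^ i | g]` is a cycle. -/
theorem exists_powerCycle (g : G) {n : ℕ} (hg : g ^ n = 1) :
    ∃ x : GrpHomology G ℤ 3, ∀ {M : Type} [AddCommGroup M] (a : (Fin 3 → G) → M)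
      (ha : coboundary 3 a = 0),
      homologyEval a ha x = ∑ i ∈ Finset.range n, a ![g, g ^ i, g] := by
  let c : (Fin 3 → G) →₀ ℤ := ∑ i ∈ Finset.range n, Finsupp.single ![g, g ^ i, g] 1
  have hs : ∀ i : ℕ, groupHomology.inhomogeneousChains.d (Rep.trivial ℤ G ℤ) 2
      (Finsupp.single ![g, g ^ i, g] (1 : ℤ)) =
      (Finsupp.single ![g, g ^ (i + 1)] (1 : ℤ) - Finsupp.single ![g ^ (i + 1), g] 1) -
      (Finsupp.single ![g, g ^ i] (1 : ℤ) - Finsupp.single ![g ^ i, g] 1) := by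
    intro i
    have h0 : (fun j : Fin 2 => (![g, g ^ i, g] : Fin 3 → G) j.succ) = ![g ^ i, g] := by
      funext j; fin_cases j <;> rfl
    have h1 : Fin.contractNth 0 (· * ·) (![g, g ^ i, g] : Fin 3 → G) = ![g ^ (i + 1), g] := by
      funext j; fin_cases j <;> simp [Fin.contractNth, pow_succ']
    have h2 : Fin.contractNth 1 (· * ·) (![g, g ^ i, g] : Fin 3 → G) = ![g, g ^ (i + 1)] := by
      funext j; fin_cases j <;> simp [Fin.contractNth, pow_succ]
    have h3 : Fin.contractNth 2 (· * ·) (![g, g ^ i, g] : Fin 3 → G) = ![g, g ^ i] := by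
      funext j; fin_cases j <;> simp [Fin.contractNth]
    refine (groupHomology.inhomogeneousChains.d_single (A := Rep.trivial ℤ G ℤ) 2 _ _).trans ?_
    rw [Fin.sum_univ_three, h0, h1, h2, h3]
    simp
    abel
  have hc : (groupHomology.inhomogeneousChains (Rep.trivial ℤ G ℤ)).d 3 2 c = 0 := by
    rw [groupHomology.inhomogeneousChains.d_def]
    refine (map_sum _ _ _).trans ?_
    refine (Finset.sum_congr rfl fun i _ => hs i).trans ?_
    refine (Finset.sum_range_sub (fun i => (Finsupp.single ![g, g ^ i] (1 : ℤ) -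
      Finsupp.single ![g ^ i, g] 1 : (Fin 2 → G) →₀ ℤ)) n).trans ?_
    simp [hg]
  refine ⟨groupHomology.π _ 3 (groupHomology.cyclesMk 3 2 (by simp) c hc), fun a ha => ?_⟩
  rw [homologyEval_π, groupHomology.iCycles_mk]
  simp [c, map_sum, Finsupp.linearCombination_single]

theorem exists_homology_generator_of_commGroup {C : Type} [CommGroup C] [Finite C] (g : C)
    (hg : ∀ x, x ∈ Subgroup.zpowers g) {i : ℕ} (hi : Odd i) :
    ∃ w : GrpHomology C ℤ i, (Nat.card C : ℤ) • w = 0 ∧ ∀ x, ∃ k : ℤ, x = k • w := by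
  classical
  have := Fintype.ofFinite C
  let A := Rep.trivial ℤ C ℤ
  let p := Rep.FiniteCyclicGroup.groupHomologyπOdd A g hg i hi
  have hp : Function.Surjective p :=
    ((ModuleCat.epi_iff_surjective
      (Rep.FiniteCyclicGroup.groupHomologyIsoOdd A g hg i hi).inv).1 inferInstance).comp <|
      ((ModuleCat.epi_iff_surjective
        (Rep.FiniteCyclicGroup.normHomCompSub A g).homologyπ).1 inferInstance).comp <|
      (ModuleCat.epi_iff_surjective
        (Rep.FiniteCyclicGroup.normHomCompSub A g).moduleCatCyclesIso.inv).1 inferInstance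
  have hker : ∀ k : ℤ, k ∈ LinearMap.ker (Rep.applyAsHom A g - 𝟙 A).hom.toLinearMap := by
    intro k
    simp [A, Rep.sub_hom, Rep.applyAsHom]
  let u : LinearMap.ker (Rep.applyAsHom A g - 𝟙 A).hom.toLinearMap := ⟨(1 : ℤ), hker 1⟩
  refine ⟨p u, ?_, fun x => ?_⟩
  · rw [← map_zsmul]
    refine (Rep.FiniteCyclicGroup.groupHomologyπOdd_eq_zero_iff A g hg i hi _).2 ⟨(1 : ℤ), ?_⟩
    simp [A, u, Representation.norm]
  · obtain ⟨k, rfl⟩ := hp x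
    refine ⟨(k.1 : ℤ), ?_⟩
    rw [← map_zsmul]
    congr 1
    apply Subtype.ext
    exact (mul_one (k.1 : ℤ)).symm

/-- The homology of a finite cyclic group of order `n` in an odd degree is cyclic and annihilated
by `n`. -/
theorem exists_homology_generator {C : Type} [Group C] [Finite C] (g : C)
    (hg : ∀ x, x ∈ Subgroup.zpowers g) {i : ℕ} (hi : Odd i) :
    ∃ w : GrpHomology C ℤ i, (Nat.card C : ℤ) • w = 0 ∧ ∀ x, ∃ k : ℤ, x = k • w := by
  let _ : CommGroup C := { ‹Group C› with
    mul_comm := fun a b => by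
      obtain ⟨m, rfl⟩ := hg a
      obtain ⟨n, rfl⟩ := hg b
      exact zpow_mul_comm g m n }
  exact exists_homology_generator_of_commGroup g hg hi

end PowerCycle

/-! ## The secondary class of the torsion rotations -/

section Secondary

variable {A : Type} [Group A]

/-- The reduction of rational numbers modulo the integers. -/
def modInt : ℚ →+ AddCircle (1 : ℚ) := QuotientAddGroup.mk' _

theorem modInt_eq_zero_iff {q : ℚ} : modInt q = 0 ↔ ∃ k : ℤ, q = k := by
  refine (AddCircle.coe_eq_zero_iff (1 : ℚ)).trans (exists_congr fun k => ?_)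
  rw [zsmul_one, eq_comm]

/-- The function `r` represents an injective homomorphism `A → ℚ/ℤ`. -/
structure IsRationalAngle (r : A → ℚ) : Prop where
  map_mul : ∀ a b, ∃ k : ℤ, r a + r b = r (a * b) + k
  eq_one : ∀ (a : A) (k : ℤ), r a = k → a = 1

/-- A function, as a cochain of degree one. -/
def oneCochain {M : Type} (r : A → M) : (Fin 1 → A) → M := fun g => r (g 0)

theorem coboundary_oneCochain {M : Type} [AddCommGroup M] (r : A → M) (g : Fin 2 → A) :
    coboundary 1 (oneCochain r) g = r (g 1) - r (g 0 * g 1) + r (g 0) := by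
  simp [coboundary_apply, oneCochain, Fin.sum_univ_two, Fin.contractNth]
  abel

theorem coboundary_coboundary {M : Type} [AddCommGroup M] {n : ℕ} (a : (Fin n → A) → M) :
    coboundary (n + 1) (coboundary n a) = 0 :=
  congr($(groupCohomology.inhomogeneousCochains.d_comp_d (A := Rep.trivial ℤ A M) (n := n)).hom a)

/-- The cup product of `r` and its coboundary. -/
noncomputable def secondaryCochain (r : A → ℚ) : (Fin 3 → A) → ℚ :=
  cupCochain (p := 1) (q := 2) rfl (oneCochain r) (coboundary 1 (oneCochain r))

theorem coboundary_secondaryCochain (r : A → ℚ) :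
    coboundary 3 (secondaryCochain r) = cupCochain (p := 2) (q := 2) rfl
      (coboundary 1 (oneCochain r)) (coboundary 1 (oneCochain r)) := by
  rw [secondaryCochain, coboundary_cupCochain, coboundary_coboundary]
  funext g
  simp [cupCochain]

namespace IsRationalAngle

variable {r : A → ℚ}

theorem map_one (hr : IsRationalAngle r) : ∃ k : ℤ, r 1 = k := by
  obtain ⟨k, hk⟩ := hr.map_mul 1 1
  rw [mul_one] at hk
  exact ⟨k, by linarith⟩

theorem map_pow (hr : IsRationalAngle r) (a : A) (n : ℕ) : ∃ k : ℤ, r (a ^ n) = n * r a + k := by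
  induction n with
  | zero =>
    obtain ⟨k, hk⟩ := hr.map_one
    exact ⟨k, by simp [hk]⟩
  | succ n ih =>
    obtain ⟨k, hk⟩ := ih
    obtain ⟨l, hl⟩ := hr.map_mul (a ^ n) a
    refine ⟨k - l, ?_⟩
    rw [pow_succ]
    push_cast
    linarith

theorem map_inv (hr : IsRationalAngle r) (a : A) : ∃ k : ℤ, r a⁻¹ = -r a + k := by
  obtain ⟨k, hk⟩ := hr.map_one
  obtain ⟨l, hl⟩ := hr.map_mul a a⁻¹
  refine ⟨k + l, ?_⟩
  rw [mul_inv_cancel] at hl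
  push_cast
  linarith

theorem map_zpow (hr : IsRationalAngle r) (a : A) (m : ℤ) :
    ∃ k : ℤ, r (a ^ m) = m * r a + k := by
  obtain ⟨n, rfl | rfl⟩ := m.eq_nat_or_neg
  · exact_mod_cast hr.map_pow a n
  · obtain ⟨k, hk⟩ := hr.map_pow a n
    obtain ⟨l, hl⟩ := hr.map_inv (a ^ n)
    refine ⟨l - k, ?_⟩
    rw [zpow_neg, zpow_natCast, hl, hk]
    push_cast
    ring

theorem zpow_eq_one_iff (hr : IsRationalAngle r) (a : A) (m : ℤ) :
    a ^ m = 1 ↔ ∃ k : ℤ, m * r a = k := by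
  obtain ⟨l, hl⟩ := hr.map_zpow a m
  constructor
  · intro h
    obtain ⟨k, hk⟩ := hr.map_one
    rw [h, hk] at hl
    exact ⟨k - l, by push_cast; linarith⟩
  · rintro ⟨k, hk⟩
    exact hr.eq_one _ (k + l) (by push_cast; linarith)

theorem eq_zpow (hr : IsRationalAngle r) {a b : A} {m k : ℤ} (h : r b = m * r a + k) :
    b = a ^ m := by
  obtain ⟨l, hl⟩ := hr.map_zpow a m
  obtain ⟨i, hi⟩ := hr.map_inv (a ^ m)
  obtain ⟨j, hj⟩ := hr.map_mul b (a ^ m)⁻¹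
  refine mul_inv_eq_one.1 (hr.eq_one _ (k - l + i - j) ?_)
  push_cast
  linarith

theorem restrict (hr : IsRationalAngle r) (S : Subgroup A) :
    IsRationalAngle fun s : S => r s :=
  ⟨fun a b => hr.map_mul a b, fun a k h => Subtype.ext (hr.eq_one a k h)⟩

theorem coboundary_oneCochain_eq_int (hr : IsRationalAngle r) (g : Fin 2 → A) :
    ∃ k : ℤ, coboundary 1 (oneCochain r) g = k := by
  obtain ⟨k, hk⟩ := hr.map_mul (g 0) (g 1)
  exact ⟨k, by rw [coboundary_oneCochain]; linarith⟩

theorem coboundary_secondaryCocycle (hr : IsRationalAngle r) :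
    coboundary 3 (modInt ∘ secondaryCochain r) = 0 := by
  rw [coboundary_comp_addMonoidHom, coboundary_secondaryCochain]
  funext g
  obtain ⟨k, hk⟩ := hr.coboundary_oneCochain_eq_int fun i => g ⟨i, by omega⟩
  obtain ⟨l, hl⟩ := hr.coboundary_oneCochain_eq_int fun i => g ⟨2 + i, by omega⟩
  refine modInt_eq_zero_iff.2 ⟨k * l, ?_⟩
  rw [cupCochain, hk, hl, Int.cast_mul]

/-- The homomorphism `H₃(A; ℤ) → ℚ/ℤ` given by the secondary class. -/
noncomputable def secondaryEval (hr : IsRationalAngle r) :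
    GrpHomology A ℤ 3 ⟶ ModuleCat.of ℤ (AddCircle (1 : ℚ)) :=
  homologyEval _ hr.coboundary_secondaryCocycle

theorem exists_secondaryEval_eq (hr : IsRationalAngle r) (g : A) {n : ℕ} (hg : g ^ n = 1) :
    ∃ x, hr.secondaryEval x = modInt (n * r g * r g) := by
  obtain ⟨x, hx⟩ := exists_powerCycle g hg
  obtain ⟨k, hk⟩ := hr.map_one
  obtain ⟨l, hl⟩ := (hr.zpow_eq_one_iff g n).1 (by exact_mod_cast hg)
  refine ⟨x, (hx _ _).trans ?_⟩
  have h : ∀ i : ℕ, secondaryCochain r ![g, g ^ i, g] =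
      r g * (r g - (r (g ^ (i + 1)) - r (g ^ i))) := by
    intro i
    have : secondaryCochain r ![g, g ^ i, g] =
      r g * coboundary 1 (oneCochain r) ![g ^ i, g] := by
      simp only [secondaryCochain, cupCochain, oneCochain]
      congr 2
      funext j
      fin_cases j <;> rfl
    rw [this, coboundary_oneCochain]
    simp only [Matrix.cons_val_zero, Matrix.cons_val_one, pow_succ]
    ring
  simp only [Function.comp_apply, h]
  rw [← map_sum, ← Finset.mul_sum, Finset.sum_sub_distrib,
    Finset.sum_range_sub fun i => r (g ^ i)]
  congr 1
  simp [hg]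
  ring

theorem secondaryEval_injective_of_cyclic [Finite A] (hr : IsRationalAngle r) (g : A)
    (hg : ∀ x, x ∈ Subgroup.zpowers g) : Function.Injective hr.secondaryEval := by
  obtain ⟨w, hw, hgen⟩ := exists_homology_generator g hg (i := 3) (by decide)
  obtain ⟨x, hx⟩ := hr.exists_secondaryEval_eq g (n := Nat.card A) pow_card_eq_one'
  obtain ⟨k, rfl⟩ := hgen x
  refine (injective_iff_map_eq_zero hr.secondaryEval.hom).2 fun y hy => ?_
  obtain ⟨j, rfl⟩ := hgen y
  have h0 : hr.secondaryEval (j • k • w) = 0 := by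
    rw [smul_comm, map_zsmul]
    exact (congrArg (k • ·) hy).trans (smul_zero k)
  rw [map_zsmul, hx, ← map_zsmul, modInt_eq_zero_iff, zsmul_eq_mul] at h0
  obtain ⟨l, hl⟩ := h0
  obtain ⟨m, hm⟩ := (hr.zpow_eq_one_iff g (Nat.card A)).1 (by simp)
  have hn : (Nat.card A : ℚ) ≠ 0 := by exact_mod_cast Nat.card_pos.ne'
  have hdvd : ∀ i : ℤ, g ^ i = 1 → (Nat.card A : ℤ) ∣ i := by
    intro i hi
    rw [← orderOf_eq_card_of_forall_mem_zpowers hg]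
    exact orderOf_dvd_iff_zpow_eq_one.2 hi
  have h1 : (Nat.card A : ℤ) ∣ j * m := hdvd _ <| (hr.zpow_eq_one_iff g _).2 ⟨l, by
    rw [← hl]
    push_cast at hm ⊢
    rw [← hm]
    ring⟩
  obtain ⟨i, hi⟩ := h1
  obtain ⟨i', hi'⟩ := hdvd j <| (hr.zpow_eq_one_iff g _).2 ⟨i, by
    have hi2 : (j * m : ℚ) = Nat.card A * i := by exact_mod_cast hi
    push_cast at hm
    apply mul_left_cancel₀ hn
    rw [← hi2, ← hm]
    ring⟩
  rw [hi', mul_comm, mul_smul, hw]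
  exact zsmul_zero i'

theorem secondaryEval_homologyInclusion (hr : IsRationalAngle r) (S : Subgroup A)
    (x : GrpHomology S ℤ 3) :
    hr.secondaryEval (homologyInclusion S ℤ 3 x) = (hr.restrict S).secondaryEval x := by
  have h : (fun s : Fin 3 → S => (modInt ∘ secondaryCochain r) fun i => s i) =
      modInt ∘ secondaryCochain fun s : S => r s := by
    funext s
    simp [secondaryCochain, cupCochain, oneCochain, coboundary_apply, Fin.sum_univ_two,
      Fin.contractNth]
  have h' := (hr.restrict S).coboundary_secondaryCocycle
  rw [secondaryEval, homologyEval_homologyInclusion S _ _ (h ▸ h'), secondaryEval]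
  congr

theorem exists_zpowers (hr : IsRationalAngle r) (hsurj : ∀ q : ℚ, ∃ (a : A) (k : ℤ), r a = q + k)
    (T : Finset A) : ∃ g : A, IsOfFinOrder g ∧ ∀ t ∈ T, t ∈ Subgroup.zpowers g := by
  obtain ⟨g, k, hg⟩ := hsurj (1 / ∏ t ∈ T, ((r t).den : ℚ))
  have hT : (∏ t ∈ T, ((r t).den : ℚ)) ≠ 0 :=
    Finset.prod_ne_zero_iff.2 fun t _ => by exact_mod_cast (r t).den_ne_zero
  refine ⟨g, isOfFinOrder_iff_zpow_eq_one.2 ⟨∏ t ∈ T, ((r t).den : ℤ), ?_, ?_⟩, fun t ht => ?_⟩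
  · exact_mod_cast hT
  · refine (hr.zpow_eq_one_iff g _).2 ⟨1 + (∏ t ∈ T, ((r t).den : ℤ)) * k, ?_⟩
    rw [hg]
    push_cast
    field_simp
  · obtain ⟨c, hc⟩ := Finset.dvd_prod_of_mem (fun t => ((r t).den : ℤ)) ht
    have hc' : (∏ t ∈ T, ((r t).den : ℚ)) = (r t).den * c := by exact_mod_cast hc
    rw [hc'] at hg hT
    refine ⟨(r t).num * c, (hr.eq_zpow (k := -((r t).num * c * k)) ?_).symm⟩
    obtain ⟨h1, h2⟩ := mul_ne_zero_iff.1 hT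
    have h3 : r t = (r t).num / (r t).den := (Rat.num_div_den _).symm
    rw [hg]
    push_cast
    generalize ((r t).num : ℚ) = x at *
    generalize ((r t).den : ℚ) = y at *
    rw [h3]
    field_simp
    ring

theorem secondaryEval_bijective (hr : IsRationalAngle r)
    (hsurj : ∀ q : ℚ, ∃ (a : A) (k : ℤ), r a = q + k) : Function.Bijective hr.secondaryEval := by
  constructor
  · refine (injective_iff_map_eq_zero hr.secondaryEval.hom).2 fun x hx => ?_
    obtain ⟨T, hT⟩ := exists_finset_mem_range_homologyInclusion x
    obtain ⟨g, hg, hgT⟩ := hr.exists_zpowers hsurj T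
    obtain ⟨y, rfl⟩ := hT _ hgT
    have : Finite (Subgroup.zpowers g) := finite_zpowers.2 hg
    have hy : (hr.restrict (Subgroup.zpowers g)).secondaryEval y = 0 := by
      rw [← secondaryEval_homologyInclusion]
      exact hx
    have := (injective_iff_map_eq_zero (hr.restrict (Subgroup.zpowers g)).secondaryEval.hom).1
      ((hr.restrict _).secondaryEval_injective_of_cyclic ⟨g, Subgroup.mem_zpowers g⟩
        (by rintro ⟨_, m, rfl⟩; exact ⟨m, Subtype.ext (by simp)⟩)) y hy
    rw [this, map_zero]
  · intro y
    obtain ⟨q, rfl⟩ : ∃ q : ℚ, modInt q = y := QuotientAddGroup.mk'_surjective _ y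
    obtain ⟨g, k, hg⟩ := hsurj (1 / q.den)
    have hden : (q.den : ℚ) ≠ 0 := by exact_mod_cast q.den_ne_zero
    have hpow : g ^ (q.den : ℤ) = 1 := (hr.zpow_eq_one_iff g _).2 ⟨1 + q.den * k, by
      rw [hg]
      push_cast
      field_simp⟩
    obtain ⟨x, hx⟩ := hr.exists_secondaryEval_eq g (n := q.den) (by exact_mod_cast hpow)
    refine ⟨q.num • x, ?_⟩
    rw [map_zsmul, hx, ← map_zsmul, ← sub_eq_zero, ← map_sub, modInt_eq_zero_iff]
    refine ⟨q.num * (2 * k + q.den * k ^ 2), ?_⟩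
    rw [hg]
    have key : ∀ a b q : ℚ, b ≠ 0 → q = a / b →
        a * (b * (1 / b + k) * (1 / b + k)) - q = a * (2 * k + b * k ^ 2) := by
      rintro a b _ hb rfl
      field_simp
      ring
    push_cast
    rw [zsmul_eq_mul]
    exact key _ _ _ hden (Rat.num_div_den q).symm

end IsRationalAngle

end Secondary

/-! ## Rational rotations -/

section Rotations

theorem cover_zero : cover 0 = 1 := by simp [cover]

theorem cover_natCast_mul (n : ℕ) (x : ℝ) : cover (n * x) = cover x ^ n := by
  induction n with
  | zero => simp [cover_zero]
  | succ n ih =>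
    rw [pow_succ, ← ih, ← cover_add]
    congr 1
    push_cast
    ring

theorem cover_eq_one_iff {x : ℝ} : cover x = 1 ↔ ∃ m : ℤ, x = m := by
  rw [← cover_zero, cover_eq_iff]
  simp

theorem cover_lift_rotation_zero (z : Circle) : cover (lift (rotation z) 0) = z := by
  rw [← isLift_lift, cover_zero]
  exact mul_one z

theorem lift_rotation (z : Circle) (x : ℝ) :
    lift (rotation z) x = lift (rotation z) 0 + x := by
  have h : IsLift (OrderIso.addLeft (lift (rotation z) 0)) (rotation z : analyticDiff) :=
    fun y => by
      conv_lhs => rw [← cover_lift_rotation_zero z]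
      exact (cover_add _ _).symm
  obtain ⟨n, hn⟩ := (isLift_lift (rotation z)).exists_eq_add_int h
  have h0 := hn 0
  simp only [OrderIso.addLeft_apply, add_zero] at h0
  rw [hn x, OrderIso.addLeft_apply]
  linarith

theorem exists_rotation_eq (a : rationalRotations) :
    ∃ z : Circle, (∃ n : ℕ, 0 < n ∧ z ^ n = 1) ∧ rotation z = a := by
  obtain ⟨z, hz, h⟩ := a.2
  obtain ⟨n, hn, hzn⟩ := isOfFinOrder_iff_pow_eq_one.1 hz
  exact ⟨z, ⟨n, hn, hzn⟩, h⟩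

theorem exists_angle (a : rationalRotations) : ∃ q : ℚ, (q : ℝ) = lift a 0 := by
  obtain ⟨z, ⟨n, hn, hz⟩, h⟩ := exists_rotation_eq a
  rw [← h]
  have h1 : cover (n * lift (rotation z) 0) = 1 := by
    rw [cover_natCast_mul, cover_lift_rotation_zero, hz]
  obtain ⟨m, hm⟩ := cover_eq_one_iff.1 h1
  have hn' : (n : ℝ) ≠ 0 := by exact_mod_cast hn.ne'
  refine ⟨m / n, ?_⟩
  push_cast
  rw [← hm, mul_div_cancel_left₀ _ hn']

/-- The angle in `[0, 1)` of a rational rotation, in units of full turns. -/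
noncomputable def angle (a : rationalRotations) : ℚ := (exists_angle a).choose

theorem angle_eq (a : rationalRotations) : (angle a : ℝ) = lift a 0 := (exists_angle a).choose_spec

theorem angle_add_angle (a b : rationalRotations) :
    angle a + angle b = angle (a * b) + eulerInt a b := by
  obtain ⟨z, -, h⟩ := exists_rotation_eq a
  have h1 := lift_lift (a : analyticDiff) b 0
  rw [← h, lift_rotation, h, ← Subgroup.coe_mul, ← angle_eq, ← angle_eq, ← angle_eq] at h1
  exact_mod_cast h1

theorem isRationalAngle_angle : IsRationalAngle angle where
  map_mul a b := ⟨_, angle_add_angle a b⟩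
  eq_one a k h := by
    obtain ⟨z, -, hz⟩ := exists_rotation_eq a
    have h1 : lift (rotation z) 0 = k := by
      rw [hz, ← angle_eq, h, Rat.cast_intCast]
    have h2 : z = 1 := by
      rw [← cover_lift_rotation_zero z]
      exact cover_eq_one_iff.2 ⟨k, h1⟩
    exact Subtype.ext (by rw [← hz, h2, map_one, Subgroup.coe_one])

theorem exists_angle_eq_add_int (q : ℚ) :
    ∃ (a : rationalRotations) (k : ℤ), angle a = q + k := by
  have hz : cover q ^ q.den = 1 := by
    rw [← cover_natCast_mul]
    refine cover_eq_one_iff.2 ⟨q.num, ?_⟩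
    exact_mod_cast Rat.den_mul_eq_num q
  have hmem : rotation (cover q) ∈ rationalRotations :=
    ⟨cover q, isOfFinOrder_iff_pow_eq_one.2 ⟨q.den, q.den_pos, hz⟩, rfl⟩
  obtain ⟨k, hk⟩ := cover_eq_iff.1 (cover_lift_rotation_zero (cover q))
  refine ⟨⟨_, hmem⟩, k, ?_⟩
  have h := angle_eq ⟨_, hmem⟩
  rw [hk] at h
  exact_mod_cast h

end Rotations

/-! ## The square of the Euler class -/

section EulerSquare

theorem coeffMap_classOf {G : Type} [Group G] {A B : Type} [AddCommGroup A] [AddCommGroup B]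
    {n : ℕ} (φ : A →+ B) (a : (Fin n → G) → A) (ha : coboundary n a = 0)
    (hb : coboundary n (φ ∘ a) = 0) :
    coeffMap φ n (classOf a ha) = classOf (φ ∘ a) hb := by
  let f : Rep.res (MonoidHom.id G) (Rep.trivial ℤ G A) ⟶ Rep.trivial ℤ G B :=
    Rep.ofHom ⟨φ.toIntLinearMap, fun _ => rfl⟩
  refine congr($(groupCohomology.π_map (MonoidHom.id G) f n).hom
    (groupCohomology.cocyclesMk a ha)).trans ?_
  refine congrArg (groupCohomology.π (Rep.trivial ℤ G B) n) ?_
  apply (ModuleCat.mono_iff_injective (groupCohomology.iCocycles (Rep.trivial ℤ G B) n)).1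
    inferInstance
  rw [groupCohomology.iCocycles_mk]
  refine congr($(HomologicalComplex.cyclesMap_i
    (groupCohomology.cochainsMap (MonoidHom.id G) f) n).hom
    (groupCohomology.cocyclesMk a ha)).trans ?_
  refine (congrArg ((groupCohomology.cochainsMap (MonoidHom.id G) f).f n)
    (groupCohomology.iCocycles_mk (A := Rep.trivial ℤ G A) a ha)).trans ?_
  rfl

/-- The Euler cocycle with rational values. -/
noncomputable def rationalEulerCocycle : (Fin 2 → analyticDiff) → ℚ :=
  Int.castAddHom ℚ ∘ eulerCocycle

theorem coboundary_rationalEulerCocycle : coboundary 2 rationalEulerCocycle = 0 := by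
  rw [rationalEulerCocycle, coboundary_comp_addMonoidHom, coboundary_eulerCocycle]
  funext g
  simp

theorem rationalEulerClass_eq :
    rationalEulerClass = classOf rationalEulerCocycle coboundary_rationalEulerCocycle :=
  coeffMap_classOf _ _ _ _

theorem coboundary_angle (g : Fin 2 → rationalRotations) :
    coboundary 1 (oneCochain angle) g = rationalEulerCocycle fun i => g i := by
  have h : (rationalEulerCocycle fun i => g i) = eulerInt (g 0) (g 1) := rfl
  rw [coboundary_oneCochain, h, sub_add, sub_eq_iff_eq_add, ← sub_eq_iff_eq_add']
  linarith [angle_add_angle (g 0) (g 1)]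

/-- If the square of the rational Euler class vanishes, the secondary class of the rational
rotations extends to the whole group. -/
theorem exists_factor_of_cup_eq_zero
    (h : cup (n := 4) rfl rationalEulerClass rationalEulerClass = 0)
    (x : GrpHomology rationalRotations ℤ 3)
    (hx : homologyInclusion rationalRotations ℤ 3 x = 0) :
    isRationalAngle_angle.secondaryEval x = 0 := by
  rw [rationalEulerClass_eq, cup_classOf, classOf_eq_zero_iff] at h
  obtain ⟨c, hc⟩ := h
  have hu : coboundary 3 (modInt ∘ c) = 0 := by
    rw [coboundary_comp_addMonoidHom, hc]
    funext g
    refine modInt_eq_zero_iff.2 ⟨eulerCocycle (fun i => g ⟨i, by omega⟩) *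
      eulerCocycle (fun i => g ⟨2 + i, by omega⟩), ?_⟩
    rw [Int.cast_mul]
    rfl
  let cA : (Fin 3 → rationalRotations) → ℚ := fun s => c fun i => s i
  have huA : coboundary 3 (modInt ∘ cA) = 0 := by
    refine (coboundary_restrict rationalRotations (modInt ∘ c)).trans ?_
    rw [hu]
    rfl
  have hw : coboundary 3 (secondaryCochain angle - cA) = 0 := by
    have h1 : coboundary 3 (secondaryCochain angle) = coboundary 3 cA := by
      rw [coboundary_secondaryCochain]
      refine Eq.trans ?_ (coboundary_restrict rationalRotations c).symm
      rw [hc]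
      funext g
      rw [cupCochain, coboundary_angle, coboundary_angle]
      rfl
    rw [coboundary, map_sub, sub_eq_zero]
    exact h1
  have hsplit : modInt ∘ (secondaryCochain angle - cA) + modInt ∘ cA =
      modInt ∘ secondaryCochain angle := by
    funext g
    simp
  have hw' : coboundary 3 (modInt ∘ (secondaryCochain angle - cA)) = 0 := by
    rw [coboundary_comp_addMonoidHom, hw]
    funext g
    simp
  have htors : homologyEval _ hw x = 0 := by
    obtain ⟨q, hq⟩ : ∃ q : ℚ, modInt q = isRationalAngle_angle.secondaryEval x :=
      QuotientAddGroup.mk'_surjective _ _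
    have h0 : (q.den : ℤ) • x = 0 := by
      apply (isRationalAngle_angle.secondaryEval_bijective exists_angle_eq_add_int).1
      rw [map_zero, map_zsmul, ← hq, ← map_zsmul]
      exact modInt_eq_zero_iff.2 ⟨q.num, by simp [Rat.den_mul_eq_num]⟩
    have h1 : (q.den : ℤ) • homologyEval _ hw x = 0 := by
      rw [← map_zsmul, h0, map_zero]
    have h2 : (q.den : ℚ) * (homologyEval _ hw x : ℚ) = 0 := by
      simpa using h1
    exact (mul_eq_zero.1 h2).resolve_left (by exact_mod_cast q.den_ne_zero)
  have h3 := homologyEval_add _ _ hw' huA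
    (by rw [hsplit]; exact isRationalAngle_angle.coboundary_secondaryCocycle) x
  have h4 : homologyEval _ huA x = 0 := by
    refine (homologyEval_homologyInclusion rationalRotations _ hu huA x).symm.trans ?_
    rw [hx, map_zero]
  rw [homologyEval_comp_addMonoidHom _ _ hw, htors, map_zero, zero_add, h4] at h3
  simp only [hsplit] at h3
  exact h3

end EulerSquare

end FlatCircle

theorem proposition1p12 :
    Nonempty (FlatCircle.GrpHomology FlatCircle.rationalRotations ℤ 3 ≃+ AddCircle (1 : ℚ)) ∧
    (¬ Function.Injective
        (FlatCircle.homologyInclusion FlatCircle.rationalRotations ℤ 3) →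
      FlatCircle.cup (n := 4) rfl FlatCircle.rationalEulerClass FlatCircle.rationalEulerClass
        ≠ 0) := by
  have hbij := FlatCircle.isRationalAngle_angle.secondaryEval_bijective
    FlatCircle.exists_angle_eq_add_int
  refine ⟨⟨AddEquiv.ofBijective
    FlatCircle.isRationalAngle_angle.secondaryEval.hom.toAddMonoidHom hbij⟩, fun hinj h => hinj ?_⟩
  refine (injective_iff_map_eq_zero
    (FlatCircle.homologyInclusion FlatCircle.rationalRotations ℤ 3).hom).2 fun x hx => ?_
  apply hbij.1
  rw [FlatCircle.exists_factor_of_cup_eq_zero h x hx, map_zero]
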